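/- Let $E$ and $F$ be (real) Banach lattices. Elements $x,y\in E$ are disjoint, $x\perp y$, if $|x|\wedge|y|=0$; $y$ is a fragment of $x$ if $y\perp x-y$. A (not necessarily linear) map $T:E\to F$ is an orthogonally additive operator if $T(x+y)=Tx+Ty$ whenever $x\perp y$; it has finite rank if its range lies in a finite-dimensional subspace of $F$; it is laterally-to-order bounded if for each $x\in E$ it maps the set of fragments of $x$ to an order bounded subset of $F$; and it is compact if it maps the closed unit ball of $E$ to a relatively compact subset of $F$. The modulus $|T|$ of an orthogonally additive operator $T:E\to F$ is the least upper bound (if it exists) of $T$ and $-T$ in the set of all orthogonally additive operators from $E$ to $F$, ordered pointwise ($S_1\le S_2$ iff $S_1x\le S_2x$ for all $x\in E$). Theorem. Let $T:E\to F$ be a finite-rank orthogonally additive operator that is continuous or, instead, laterally-to-order bounded, and suppose that $T$ is norm bounded on the closed unit ball of $E$. Then the modulus $|T|$ exists and is a compact orthogonally additive operator. -/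

import Mathlib

section OrthogonallyAdditive

variable {E F : Type*}

/-- `x ⊥ y` in a vector lattice: `|x| ⊓ |y| = 0`. -/
def LatticeDisjoint [Lattice E] [AddCommGroup E] (x y : E) : Prop :=
  |x| ⊓ |y| = 0

/-- The set of all fragments (components) of `x`: those `y` with `y ⊥ x - y`. -/
def fragments [Lattice E] [AddCommGroup E] (x : E) : Set E :=
  {y | LatticeDisjoint y (x - y)}

/-- `T (x + y) = T x + T y` for all disjoint `x`, `y`. -/
def IsOrthogonallyAdditive [Lattice E] [AddCommGroup E] [AddCommGroup F] (T : E → F) : Prop :=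
  ∀ x y : E, LatticeDisjoint x y → T (x + y) = T x + T y

/-- `T` maps the set of fragments of each element to an order bounded set. -/
def IsLaterallyToOrderBounded [Lattice E] [AddCommGroup E] [Preorder F] (T : E → F) : Prop :=
  ∀ x : E, BddBelow (T '' fragments x) ∧ BddAbove (T '' fragments x)

/-- The range of `T` spans a finite-dimensional subspace. -/
def HasFiniteRank [AddCommGroup F] [Module ℝ F] (T : E → F) : Prop :=
  FiniteDimensional ℝ (Submodule.span ℝ (Set.range T))

/-- `T` is orthogonally additive and maps the closed unit ball to a relatively compact set. -/
def IsCompactOrthogonallyAdditive [Lattice E] [NormedAddCommGroup E] [NormedAddCommGroup F]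
    (T : E → F) : Prop :=
  IsOrthogonallyAdditive T ∧ IsCompact (closure (T '' Metric.closedBall (0 : E) 1))

/-- `R` is the modulus `T ∨ (-T)` of `T`: the least upper bound of `T` and `-T` among the
orthogonally additive operators `E → F`, ordered by `S₁ ≤ S₂` iff `S₁ x ≤ S₂ x` for all `x`
(that is, iff `S₂ - S₁` is positive). -/
def IsModulus [Lattice E] [AddCommGroup E] [Lattice F] [AddCommGroup F] (T R : E → F) : Prop :=
  IsLeast {S : E → F | IsOrthogonallyAdditive S ∧ T ≤ S ∧ -T ≤ S} R

end OrthogonallyAdditive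

/-! ### Disjointness and fragments in vector lattices. -/

section LatticeGroup

variable {E : Type*} [Lattice E] [AddCommGroup E] [IsOrderedAddMonoid E]

/-! The modulus is given by the Riesz–Kantorovich formula: `R x` is the supremum of `T y - T (x -
y)` over the fragments `y` of `x` (`isModulus_of_isLUB`). Since `F` need not be Dedekind complete,
these suprema must be shown to exist. The values lie in the finite-dimensional span `W` of the
range; with `u` the sum of the absolute values of a basis of `W`, a norm bounded subset of `W` has
finite nets with errors in `[-ε u, ε u]`. Order errors, unlike norm errors, pass through arbitrary
suprema, so suprema of subsets are approximated by finite suprema of net points. Norm completeness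
then yields existence, and the finiteness of the set of approximants yields compactness.

Only boundedness of the values remains. For a single `x` it comes from lateral boundedness or from
continuity; over the unit ball it comes from the norm bound on `T`, as fragments of elements of the
ball stay in the ball. -/

lemma inf_add_le_inf_add_inf {a b c : E} (ha : 0 ≤ a) (hb : 0 ≤ b) (hc : 0 ≤ c) :
    a ⊓ (b + c) ≤ a ⊓ b + a ⊓ c := by
  rw [← sub_le_iff_le_add']
  refine le_inf ((sub_le_self _ (le_inf ha hb)).trans inf_le_left) ?_
  rw [sub_le_comm]
  exact le_inf ((sub_le_self _ hc).trans inf_le_left)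
    (sub_le_iff_le_add.2 inf_le_right)

lemma abs_le_abs_of_le_posPart_of_neg_negPart_le {a w : E} (h₁ : a ≤ w⁺) (h₂ : -w⁻ ≤ a) :
    |a| ≤ |w| := by
  refine abs_le'.2 ⟨h₁.trans ?_, (neg_le.1 h₂).trans ?_⟩
  · exact sup_le (le_abs_self w) (abs_nonneg w)
  · exact sup_le (neg_le_abs w) (abs_nonneg w)

/-- The Riesz decomposition property, with both parts dominated by the decomposed element. -/
lemma exists_add_eq_of_abs_le_add {w p q : E} (hp : 0 ≤ p) (hq : 0 ≤ q) (h : |w| ≤ p + q) :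
    ∃ y z, y + z = w ∧ |y| ≤ p ∧ |z| ≤ q ∧ |y| ≤ |w| ∧ |z| ≤ |w| := by
  have h₁ : w⁺ ≤ p + q := (sup_le (le_abs_self w) (abs_nonneg w)).trans h
  have h₂ : w⁻ ≤ p + q := (sup_le (neg_le_abs w) (abs_nonneg w)).trans h
  have key : ∀ a : E, 0 ≤ a → a ≤ p + q →
      0 ≤ a ⊓ p ∧ a ⊓ p ≤ p ∧ a ⊓ p ≤ a ∧ 0 ≤ a - a ⊓ p ∧ a - a ⊓ p ≤ q ∧ a - a ⊓ p ≤ a := by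
    intro a ha haq
    refine ⟨le_inf ha hp, inf_le_right, inf_le_left, sub_nonneg.2 inf_le_left, ?_,
      sub_le_self _ (le_inf ha hp)⟩
    rw [sub_le_comm]
    exact le_inf (sub_le_self _ hq) (sub_le_iff_le_add.2 haq)
  obtain ⟨a1, a2, a3, a4, a5, a6⟩ := key w⁺ (posPart_nonneg w) h₁
  obtain ⟨b1, b2, b3, b4, b5, b6⟩ := key w⁻ (negPart_nonneg w) h₂
  have sub_bounds : ∀ {a b r s : E}, 0 ≤ a → 0 ≤ b → a ≤ r → b ≤ s → a - b ≤ r ∧ -s ≤ a - b := by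
    intro a b r s ha hb har hbs
    exact ⟨(sub_le_self _ hb).trans har, by
      rw [sub_eq_add_neg]; exact (neg_le_neg hbs).trans (le_add_of_nonneg_left ha)⟩
  refine ⟨w⁺ ⊓ p - w⁻ ⊓ p, (w⁺ - w⁺ ⊓ p) - (w⁻ - w⁻ ⊓ p), ?_, ?_, ?_, ?_, ?_⟩
  · calc _ = w⁺ - w⁻ := by abel
      _ = w := posPart_sub_negPart w
  · have := sub_bounds a1 b1 a2 b2
    exact abs_le'.2 ⟨this.1, neg_le.1 this.2⟩
  · have := sub_bounds a4 b4 a5 b5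
    exact abs_le'.2 ⟨this.1, neg_le.1 this.2⟩
  · have := sub_bounds a1 b1 a3 b3
    exact abs_le_abs_of_le_posPart_of_neg_negPart_le this.1 this.2
  · have := sub_bounds a4 b4 a6 b6
    exact abs_le_abs_of_le_posPart_of_neg_negPart_le this.1 this.2

namespace LatticeDisjoint

lemma symm {x y : E} (h : LatticeDisjoint x y) : LatticeDisjoint y x := by
  rwa [LatticeDisjoint, inf_comm]

lemma mono {x y x' y' : E} (h : LatticeDisjoint x y) (hx : |x'| ≤ |x|) (hy : |y'| ≤ |y|) :
    LatticeDisjoint x' y' :=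
  le_antisymm ((inf_le_inf hx hy).trans h.le) (le_inf (abs_nonneg _) (abs_nonneg _))

lemma add_right {x y z : E} (hy : LatticeDisjoint x y) (hz : LatticeDisjoint x z) :
    LatticeDisjoint x (y + z) := by
  refine le_antisymm ?_ (le_inf (abs_nonneg _) (abs_nonneg _))
  calc |x| ⊓ |y + z| ≤ |x| ⊓ (|y| + |z|) := inf_le_inf_left _ (abs_add_le y z)
    _ ≤ |x| ⊓ |y| + |x| ⊓ |z| :=
      inf_add_le_inf_add_inf (abs_nonneg _) (abs_nonneg _) (abs_nonneg _)
    _ = 0 := by rw [hy, hz, add_zero]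

lemma neg_right {x y : E} (h : LatticeDisjoint x y) : LatticeDisjoint x (-y) :=
  h.mono le_rfl (abs_neg y).le

lemma sub_right {x y z : E} (hy : LatticeDisjoint x y) (hz : LatticeDisjoint x z) :
    LatticeDisjoint x (y - z) := by
  rw [sub_eq_add_neg]
  exact hy.add_right hz.neg_right

lemma add_left {x y z : E} (hx : LatticeDisjoint x z) (hy : LatticeDisjoint y z) :
    LatticeDisjoint (x + y) z :=
  (hx.symm.add_right hy.symm).symm

lemma sub_left {x y z : E} (hx : LatticeDisjoint x z) (hy : LatticeDisjoint y z) :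
    LatticeDisjoint (x - y) z :=
  (hx.symm.sub_right hy.symm).symm

lemma eq_zero_of_self {x : E} (h : LatticeDisjoint x x) : x = 0 := by
  have h0 : |x| = 0 := by simpa [LatticeDisjoint] using h
  exact le_antisymm ((le_abs_self x).trans h0.le)
    (neg_nonpos.1 ((neg_le_abs x).trans h0.le))

lemma abs_le_abs_add {x y : E} (h : LatticeDisjoint x y) : |x| ≤ |x + y| := by
  have h₁ : |x| ≤ |x + y| + |y| := by
    simpa using abs_add_le (x + y) (-y)
  calc |x| = |x| ⊓ (|x + y| + |y|) := (inf_eq_left.2 h₁).symm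
    _ ≤ |x| ⊓ |x + y| + |x| ⊓ |y| :=
      inf_add_le_inf_add_inf (abs_nonneg _) (abs_nonneg _) (abs_nonneg _)
    _ = |x| ⊓ |x + y| := by rw [show |x| ⊓ |y| = 0 from h, add_zero]
    _ ≤ |x + y| := inf_le_right

end LatticeDisjoint

lemma latticeDisjoint_zero_right (x : E) : LatticeDisjoint x 0 := by
  simp [LatticeDisjoint]

lemma zero_mem_fragments (x : E) : (0 : E) ∈ fragments x :=
  (latticeDisjoint_zero_right _).symm

lemma self_mem_fragments (x : E) : x ∈ fragments x := by
  simpa [fragments] using latticeDisjoint_zero_right x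

lemma sub_mem_fragments {x y : E} (h : y ∈ fragments x) : x - y ∈ fragments x := by
  simpa [fragments] using h.symm

lemma abs_le_abs_of_mem_fragments {x y : E} (h : y ∈ fragments x) : |y| ≤ |x| := by
  simpa using LatticeDisjoint.abs_le_abs_add h

lemma add_mem_fragments_add {u v y z : E} (h : LatticeDisjoint u v) (hy : y ∈ fragments u)
    (hz : z ∈ fragments v) : y + z ∈ fragments (u + v) := by
  have hy' := abs_le_abs_of_mem_fragments hy
  have hz' := abs_le_abs_of_mem_fragments hz
  have hy'' := abs_le_abs_of_mem_fragments (sub_mem_fragments hy)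
  have hz'' := abs_le_abs_of_mem_fragments (sub_mem_fragments hz)
  have : u + v - (y + z) = (u - y) + (v - z) := by abel
  rw [fragments, Set.mem_ofPred_eq, this]
  exact LatticeDisjoint.add_left (LatticeDisjoint.add_right hy (h.mono hy' hz''))
    (LatticeDisjoint.add_right (h.symm.mono hz' hy'') hz)

/-- Riesz decomposition splits both `w` and `u + v - w` into parts dominated by `|u|` and `|v|`. The
defects `u - (y + y')` and `(z + z') - v` are equal and disjoint, hence zero. Thus `u - y = y'`, and
`y ⊥ y'` because they are dominated by the disjoint elements `w` and `u + v - w`. -/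
lemma exists_fragments_add_eq {u v w : E} (h : LatticeDisjoint u v) (hw : w ∈ fragments (u + v)) :
    ∃ y ∈ fragments u, ∃ z ∈ fragments v, y + z = w := by
  have hle : ∀ w ∈ fragments (u + v), |w| ≤ |u| + |v| := fun w hw =>
    (abs_le_abs_of_mem_fragments hw).trans (abs_add_le u v)
  obtain ⟨y, z, hyz, hy, hz, hyw, hzw⟩ :=
    exists_add_eq_of_abs_le_add (abs_nonneg u) (abs_nonneg v) (hle w hw)
  obtain ⟨y', z', hyz', hy', hz', hyw', hzw'⟩ :=
    exists_add_eq_of_abs_le_add (abs_nonneg u) (abs_nonneg v) (hle _ (sub_mem_fragments hw))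
  have huz : ∀ {a b}, |a| ≤ |u| → |b| ≤ |v| → LatticeDisjoint a b := fun ha hb => h.mono ha hb
  have hsum : u - (y + y') = (z + z') - v := by
    have : (y + y') + (z + z') = u + v := by
      calc (y + y') + (z + z') = (y + z) + (y' + z') := by abel
        _ = u + v := by rw [hyz, hyz', add_sub_cancel]
    rw [sub_eq_sub_iff_add_eq_add, add_comm (z + z'), this]
  have hdisj : LatticeDisjoint (u - (y + y')) ((z + z') - v) := by
    have aux : ∀ {b}, |b| ≤ |v| → LatticeDisjoint (u - (y + y')) b := fun hb =>
      (huz le_rfl hb).sub_left ((huz hy hb).add_left (huz hy' hb))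
    exact ((aux hz).add_right (aux hz')).sub_right (aux le_rfl)
  have hu : u - (y + y') = 0 := by
    refine LatticeDisjoint.eq_zero_of_self ?_
    nth_rewrite 2 [hsum]
    exact hdisj
  have hv : (z + z') - v = 0 := hsum ▸ hu
  have hw' : LatticeDisjoint w (u + v - w) := hw
  refine ⟨y, ?_, z, ?_, hyz⟩
  · have : u - y = y' := by rw [sub_eq_zero.1 hu]; abel
    rw [fragments, Set.mem_ofPred_eq, this]
    exact hw'.mono hyw hyw'
  · have : v - z = z' := by rw [← sub_eq_zero.1 hv]; abel
    rw [fragments, Set.mem_ofPred_eq, this]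
    exact hw'.mono hzw hzw'

lemma abs_smul_le [Module ℝ E] [IsOrderedModule ℝ E] (c : ℝ) (x : E) : |c • x| ≤ |c| • |x| := by
  rcases le_total 0 c with hc | hc
  · rw [abs_of_nonneg hc]
    refine abs_le'.2 ⟨smul_le_smul_of_nonneg_left (le_abs_self x) hc, ?_⟩
    rw [← smul_neg]
    exact smul_le_smul_of_nonneg_left (neg_le_abs x) hc
  · rw [abs_of_nonpos hc, ← abs_neg, ← neg_smul]
    have hc' : 0 ≤ -c := neg_nonneg.2 hc
    refine abs_le'.2 ⟨smul_le_smul_of_nonneg_left (le_abs_self x) hc', ?_⟩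
    rw [← smul_neg]
    exact smul_le_smul_of_nonneg_left (neg_le_abs x) hc'

lemma LatticeDisjoint.smul_smul [Module ℝ E] [IsOrderedModule ℝ E] {x y : E}
    (h : LatticeDisjoint x y) (s t : ℝ) : LatticeDisjoint (s • x) (t • y) := by
  set c : ℝ := |s| + |t| + 1 with hc
  have hs := abs_nonneg s
  have ht := abs_nonneg t
  have hc0 : 0 < c := by linarith
  have hx : |s • x| ≤ c • |x| :=
    (abs_smul_le s x).trans (smul_le_smul_of_nonneg_right (by linarith) (abs_nonneg x))
  have hy : |t • y| ≤ c • |y| :=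
    (abs_smul_le t y).trans (smul_le_smul_of_nonneg_right (by linarith) (abs_nonneg y))
  refine le_antisymm ((inf_le_inf hx hy).trans ?_) (le_inf (abs_nonneg _) (abs_nonneg _))
  have := (OrderIso.smulRight hc0).map_inf |x| |y|
  simp only [OrderIso.smulRight_apply] at this
  rw [← this, show |x| ⊓ |y| = 0 from h, smul_zero]

end LatticeGroup

/-! ### The Riesz–Kantorovich formula. -/

section OrthogonallyAdditive

variable {E F : Type*} [Lattice E] [AddCommGroup E] [IsOrderedAddMonoid E] [AddCommGroup F]
  {T : E → F}

lemma IsOrthogonallyAdditive.map_zero (hT : IsOrthogonallyAdditive T) : T 0 = 0 := by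
  have := hT 0 0 (latticeDisjoint_zero_right 0)
  simpa using this

lemma IsOrthogonallyAdditive.map_add_map_sub (hT : IsOrthogonallyAdditive T) {x y : E}
    (hy : y ∈ fragments x) : T y + T (x - y) = T x := by
  rw [← hT y (x - y) hy, add_sub_cancel]

lemma IsOrthogonallyAdditive.map_sub_map_sub_of_fragments (hT : IsOrthogonallyAdditive T)
    {u v y z : E} (huv : LatticeDisjoint u v) (hy : y ∈ fragments u) (hz : z ∈ fragments v) :
    T (y + z) - T (u + v - (y + z)) = (T y - T (u - y)) + (T z - T (v - z)) := by
  have h₁ : T (y + z) = T y + T z :=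
    hT y z (huv.mono (abs_le_abs_of_mem_fragments hy) (abs_le_abs_of_mem_fragments hz))
  have h₂ : T ((u - y) + (v - z)) = T (u - y) + T (v - z) :=
    hT _ _ (huv.mono (abs_le_abs_of_mem_fragments (sub_mem_fragments hy))
      (abs_le_abs_of_mem_fragments (sub_mem_fragments hz)))
  rw [add_sub_add_comm, h₁, h₂, add_sub_add_comm]

/-- The values `T y - T (x - y)` on the fragments `y` of `x`, whose supremum is `|T| x`. -/
def signedFragmentValues (T : E → F) (x : E) : Set F :=
  (fun y => T y - T (x - y)) '' fragments x

lemma signedFragmentValues_nonempty (T : E → F) (x : E) : (signedFragmentValues T x).Nonempty :=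
  ⟨_, 0, zero_mem_fragments x, rfl⟩

lemma signedFragmentValues_subset_span (T : E → F) [Module ℝ F] (x : E) :
    signedFragmentValues T x ⊆ Submodule.span ℝ (Set.range T) := by
  rintro _ ⟨y, -, rfl⟩
  exact sub_mem (Submodule.subset_span ⟨_, rfl⟩) (Submodule.subset_span ⟨_, rfl⟩)

variable [Lattice F] [IsOrderedAddMonoid F]

/-- The Riesz–Kantorovich formula for the modulus of an orthogonally additive operator. -/
theorem isModulus_of_isLUB (hT : IsOrthogonallyAdditive T) {R : E → F}
    (hR : ∀ x, IsLUB (signedFragmentValues T x) (R x)) : IsModulus T R := by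
  refine ⟨⟨?_, ?_, ?_⟩, ?_⟩
  · intro u v huv
    refine (hR (u + v)).unique ⟨?_, ?_⟩
    · rintro _ ⟨w, hw, rfl⟩
      obtain ⟨y, hy, z, hz, rfl⟩ := exists_fragments_add_eq huv hw
      simp only [hT.map_sub_map_sub_of_fragments huv hy hz]
      exact add_le_add ((hR u).1 ⟨y, hy, rfl⟩) ((hR v).1 ⟨z, hz, rfl⟩)
    -- The two fragments vary independently, so the supremum is taken over one at a time.
    · intro b hb
      rw [← le_sub_iff_add_le]
      refine (hR u).2 ?_
      rintro _ ⟨y, hy, rfl⟩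
      rw [le_sub_comm]
      refine (hR v).2 ?_
      rintro _ ⟨z, hz, rfl⟩
      rw [le_sub_iff_add_le', ← hT.map_sub_map_sub_of_fragments huv hy hz]
      exact hb ⟨y + z, add_mem_fragments_add huv hy hz, rfl⟩
  · intro x
    exact (hR x).1 ⟨x, self_mem_fragments x, by simp [hT.map_zero]⟩
  · intro x
    exact (hR x).1 ⟨0, zero_mem_fragments x, by simp [hT.map_zero]⟩
  · rintro S ⟨hS, hTS, hTS'⟩ x
    refine (hR x).2 ?_
    rintro _ ⟨y, hy, rfl⟩
    rw [← hS.map_add_map_sub hy]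
    show T y - T (x - y) ≤ _
    rw [sub_eq_add_neg]
    exact add_le_add (hTS y) (hTS' (x - y))

end OrthogonallyAdditive

/-! ### Suprema of sets that are totally bounded for an order interval. -/

section OrderUnitTotallyBounded

variable {F : Type*} [NormedAddCommGroup F] [NormedSpace ℝ F] [Lattice F]
  [IsOrderedAddMonoid F] [IsOrderedModule ℝ F] [HasSolidNorm F]

/-- Total boundedness of `K` for the gauge of the order interval `[-u, u]`. -/
def OrderUnitTotallyBounded (u : F) (K : Set F) : Prop :=
  ∀ ε > (0 : ℝ), ∃ t : Finset F, ∀ k ∈ K, ∃ j ∈ t, |k - j| ≤ ε • u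

open Classical in
/-- The points of `t` within `ε • u` of a point of `A`. -/
noncomputable def Finset.nearPoints (u : F) (A : Set F) (t : Finset F) (ε : ℝ) : Finset F :=
  {j ∈ t | ∃ a ∈ A, |a - j| ≤ ε • u}

/-- Net points far from `A` are discarded, since they could push the finite supremum above the upper
bounds of `A`. -/
lemma Finset.exists_nearPoints_sup' {u : F} {A : Set F} (hA : A.Nonempty) {t : Finset F} {ε : ℝ}
    (ht : ∀ k ∈ A, ∃ j ∈ t, |k - j| ≤ ε • u) :
    ∃ h : (t.nearPoints u A ε).Nonempty,
      (∀ a ∈ A, a ≤ (t.nearPoints u A ε).sup' h id + ε • u) ∧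
      ∀ b ∈ upperBounds A, (t.nearPoints u A ε).sup' h id ≤ b + ε • u := by
  have hmem : ∀ a ∈ A, ∃ j ∈ t.nearPoints u A ε, |a - j| ≤ ε • u := by
    intro a ha
    obtain ⟨j, hj, haj⟩ := ht a ha
    exact ⟨j, by classical exact Finset.mem_filter.2 ⟨hj, a, ha, haj⟩, haj⟩
  obtain ⟨a₀, ha₀⟩ := hA
  obtain ⟨j₀, hj₀, -⟩ := hmem a₀ ha₀
  refine ⟨⟨j₀, hj₀⟩, fun a ha => ?_, fun b hb => Finset.sup'_le _ _ fun j hj => ?_⟩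
  · obtain ⟨j, hj, haj⟩ := hmem a ha
    calc a ≤ ε • u + j := sub_le_iff_le_add.1 ((le_abs_self _).trans haj)
      _ ≤ _ := by
        rw [add_comm]
        exact add_le_add_left (Finset.le_sup' id hj) _
  · classical
    obtain ⟨-, a, ha, haj⟩ := Finset.mem_filter.1 hj
    rw [abs_sub_comm] at haj
    calc j ≤ ε • u + a := sub_le_iff_le_add.1 ((le_abs_self _).trans haj)
      _ ≤ _ := by
        rw [add_comm]
        exact add_le_add_left (hb ha) _

lemma norm_sub_le_of_le_add_smul {u a b : F} (hu : 0 ≤ u) {ε : ℝ} (hε : 0 ≤ ε)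
    (hab : a ≤ b + ε • u) (hba : b ≤ a + ε • u) : ‖a - b‖ ≤ ε * ‖u‖ := by
  have h : |a - b| ≤ |ε • u| := by
    rw [abs_of_nonneg (smul_nonneg hε hu)]
    refine abs_le'.2 ⟨sub_le_iff_le_add'.2 hab, ?_⟩
    rw [neg_sub]
    exact sub_le_iff_le_add'.2 hba
  simpa [norm_smul, abs_of_nonneg hε] using norm_le_norm_of_abs_le_abs h

lemma OrderUnitTotallyBounded.exists_isLUB [CompleteSpace F] {u : F} (hu : 0 ≤ u) {K : Set F}
    (hK : OrderUnitTotallyBounded u K) (hne : K.Nonempty) : ∃ s, IsLUB K s := by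
  set ε : ℕ → ℝ := fun n => 1 / ((n : ℝ) + 1) with hε
  have hε0 : ∀ n, 0 < ε n := fun n => by simp only [hε]; positivity
  have hεlim : Filter.Tendsto ε Filter.atTop (nhds 0) := tendsto_one_div_add_atTop_nhds_zero_nat
  have hex : ∀ n, ∃ s : F, (∀ a ∈ K, a ≤ s + ε n • u) ∧
      (∀ b ∈ upperBounds K, s ≤ b + ε n • u) := by
    intro n
    obtain ⟨t, ht⟩ := hK (ε n) (hε0 n)
    obtain ⟨h, h₁, h₂⟩ := Finset.exists_nearPoints_sup' hne ht
    exact ⟨_, h₁, h₂⟩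
  choose s hs₁ hs₂ using hex
  have hle : ∀ n m, s n ≤ s m + (ε n + ε m) • u := by
    intro n m
    rw [add_smul, add_comm (ε n • u), ← add_assoc]
    -- `s m + ε m • u` is itself an upper bound of `K`; hence the approximate suprema are Cauchy.
    exact hs₂ n _ fun a ha => hs₁ m a ha
  have hcauchy : CauchySeq s := by
    rw [Metric.cauchySeq_iff']
    intro δ hδ
    have hlim : Filter.Tendsto (fun n => (ε n + ε n) * ‖u‖) Filter.atTop (nhds 0) := by
      simpa using (hεlim.add hεlim).mul_const ‖u‖
    obtain ⟨N, hN⟩ := (hlim.eventually (gt_mem_nhds hδ)).exists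
    refine ⟨N, fun n hn => ?_⟩
    rw [dist_eq_norm]
    have hnN : ε n ≤ ε N := one_div_le_one_div_of_le (by positivity) (by gcongr)
    calc ‖s n - s N‖ ≤ (ε n + ε N) * ‖u‖ :=
          norm_sub_le_of_le_add_smul hu (add_pos (hε0 n) (hε0 N)).le (hle n N)
            (by rw [add_comm (ε n)]; exact hle N n)
      _ ≤ (ε N + ε N) * ‖u‖ := by gcongr
      _ < δ := hN
  obtain ⟨l, hl⟩ := cauchySeq_tendsto_of_complete hcauchy
  have hεu : Filter.Tendsto (fun n => ε n • u) Filter.atTop (nhds 0) := by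
    simpa using hεlim.smul_const u
  refine ⟨l, fun a ha => ?_, fun b hb => ?_⟩
  · refine ge_of_tendsto' (by simpa using hl.add hεu) fun n => hs₁ n a ha
  · refine le_of_tendsto_of_tendsto' hl (by simpa using tendsto_const_nhds.add hεu)
      fun n => hs₂ n b hb

/-- The suprema of the nonempty subsets of `K` form a totally bounded set in norm. -/
lemma OrderUnitTotallyBounded.totallyBounded_isLUB {u : F} (hu : 0 ≤ u) {K : Set F}
    (hK : OrderUnitTotallyBounded u K) :
    TotallyBounded {s | ∃ A ⊆ K, A.Nonempty ∧ IsLUB A s} := by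
  classical
  rw [Metric.totallyBounded_iff]
  intro δ hδ
  have hu' : 0 < ‖u‖ + 1 := by positivity
  set ε : ℝ := δ / (‖u‖ + 1) with hε
  have hε0 : 0 < ε := by positivity
  have hεδ : ε * ‖u‖ < δ := by
    rw [hε, div_mul_eq_mul_div, div_lt_iff₀ hu']
    nlinarith
  obtain ⟨t, ht⟩ := hK ε hε0
  -- One candidate centre per subset of the net; the default `0` is harmless, as the sets of near
  -- points used below are nonempty.
  set g : Finset F → F := fun S => if h : S.Nonempty then S.sup' h id else 0 with hg
  refine ⟨g '' (t.powerset : Set (Finset F)), (Finset.finite_toSet _).image g, ?_⟩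
  rintro s ⟨A, hAK, hA, hs⟩
  obtain ⟨h, h₁, h₂⟩ := Finset.exists_nearPoints_sup' hA fun k hk => ht k (hAK hk)
  refine Set.mem_biUnion ⟨t.nearPoints u A ε, ?_, rfl⟩ ?_
  · exact Finset.mem_coe.2 (Finset.mem_powerset.2 (Finset.filter_subset _ _))
  · rw [Metric.mem_ball, dist_eq_norm, hg]
    simp only [dif_pos h]
    exact (norm_sub_le_of_le_add_smul hu hε0.le (hs.2 fun a ha => h₁ a ha)
      (h₂ s hs.1)).trans_lt hεδ

/-- Norm bounded sets of a finite-dimensional subspace are totally bounded for the gauge of one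
order interval. -/
lemma Submodule.exists_orderUnitTotallyBounded (W : Submodule ℝ F) [FiniteDimensional ℝ W] :
    ∃ u : F, 0 ≤ u ∧
      ∀ K : Set F, K ⊆ W → Bornology.IsBounded K → OrderUnitTotallyBounded u K := by
  classical
  let b := Module.finBasis ℝ W
  let e := b.equivFunL
  refine ⟨∑ i, |(b i : F)|, Finset.sum_nonneg fun i _ => abs_nonneg _, fun K hKW hK ε hε => ?_⟩
  -- The sup norm of the coordinates controls the gauge of `[-u, u]`, so a finite net in coordinate
  -- space transfers.
  have habs : ∀ w : W, |(w : F)| ≤ ‖e w‖ • ∑ i, |(b i : F)| := by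
    intro w
    have hw : (w : F) = ∑ i, e w i • (b i : F) := by
      conv_lhs => rw [← b.sum_equivFun w, W.coe_sum]
      rfl
    rw [hw, Finset.smul_sum]
    refine (Finset.le_sum_of_subadditive (|·|) abs_zero.le abs_add_le _ _).trans
      (Finset.sum_le_sum fun i _ => ?_)
    exact (abs_smul_le _ _).trans
      (smul_le_smul_of_nonneg_right (norm_le_pi_norm (e w) i) (abs_nonneg _))
  have hK' : Bornology.IsBounded ((↑) ⁻¹' K : Set W) := by
    obtain ⟨C, hC⟩ := isBounded_iff_forall_norm_le.1 hK
    exact isBounded_iff_forall_norm_le.2 ⟨C, fun w hw => hC _ hw⟩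
  have hb : Bornology.IsBounded (e '' ((↑) ⁻¹' K : Set W)) := e.lipschitz.isBounded_image hK'
  have htb := hb.isCompact_closure.totallyBounded.subset subset_closure
  obtain ⟨t, ht, htK⟩ := Metric.totallyBounded_iff.1 htb ε hε
  refine ⟨ht.toFinset.image fun c => (e.symm c : F), fun k hk => ?_⟩
  obtain ⟨c, hc, hkc⟩ := Set.mem_iUnion₂.1 (htK ⟨⟨k, hKW hk⟩, hk, rfl⟩)
  refine ⟨_, Finset.mem_image_of_mem _ (ht.mem_toFinset.2 hc), ?_⟩
  have := habs (⟨k, hKW hk⟩ - e.symm c)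
  refine this.trans (smul_le_smul_of_nonneg_right ?_ (Finset.sum_nonneg fun i _ => abs_nonneg _))
  rw [map_sub, e.apply_symm_apply]
  rw [Metric.mem_ball, dist_eq_norm] at hkc
  exact hkc.le

end OrderUnitTotallyBounded

/-! ### Boundedness on the fragments of an element. -/

section BoundedOnFragments

variable {E : Type*} [NormedAddCommGroup E] [NormedSpace ℝ E] [Lattice E] [IsOrderedAddMonoid E]
  {F : Type*} [NormedAddCommGroup F] {T : E → F}

lemma IsLaterallyToOrderBounded.isBounded_image_fragments [Lattice F] [IsOrderedAddMonoid F]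
    [HasSolidNorm F] (hT : IsLaterallyToOrderBounded T) (x : E) :
    Bornology.IsBounded (T '' fragments x) := by
  obtain ⟨⟨a, ha⟩, ⟨b, hb⟩⟩ := hT x
  refine isBounded_iff_forall_norm_le.2 ⟨‖|a| + |b|‖, fun z hz => norm_le_norm_of_abs_le_abs ?_⟩
  rw [abs_of_nonneg (add_nonneg (abs_nonneg a) (abs_nonneg b))]
  refine abs_le'.2 ⟨?_, ?_⟩
  · exact (hb hz).trans ((le_abs_self b).trans (le_add_of_nonneg_left (abs_nonneg a)))
  · exact (neg_le_neg (ha hz)).trans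
      ((neg_le_abs a).trans (le_add_of_nonneg_right (abs_nonneg b)))

/-- A connectedness argument in the scale `s`: the set `G` of those `s` for which `T` is bounded on
the `s`-multiples of fragments is clopen and contains `0`, so it contains `1`. -/
lemma IsOrthogonallyAdditive.isBounded_image_fragments [IsOrderedModule ℝ E] [HasSolidNorm E]
    (hT : IsOrthogonallyAdditive T) (hc : Continuous T) (x : E) :
    Bornology.IsBounded (T '' fragments x) := by
  set G : Set ℝ := {s | ∃ C, ∀ y ∈ fragments x, ‖T (s • y)‖ ≤ C} with hG
  have hsplit : ∀ y ∈ fragments x, ∀ s t : ℝ,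
      T (s • (x - y) + t • y) = T (s • (x - y)) + T (t • y) := fun y hy s t =>
    hT _ _ ((LatticeDisjoint.symm hy).smul_smul s t)
  -- `s • (x - y) + t • y` is within `|t - s| * ‖x‖` of `s • x`, uniformly in `y`. Continuity at the
  -- single point `s • x` suffices, since the common term `T (s • (x - y))` cancels.
  have hnear : ∀ s : ℝ, ∀ᶠ t in nhds s, ∀ y ∈ fragments x, ‖T (t • y) - T (s • y)‖ ≤ 1 := by
    intro s
    obtain ⟨δ, hδ, hTδ⟩ := Metric.continuous_iff.1 hc (s • x) 1 one_pos
    have hlim : Filter.Tendsto (fun t : ℝ => |t - s| * ‖x‖) (nhds s) (nhds 0) := by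
      have : Continuous fun t : ℝ => |t - s| * ‖x‖ := by fun_prop
      simpa using this.tendsto s
    filter_upwards [hlim.eventually (gt_mem_nhds hδ)] with t ht y hy
    have hy' : ‖y‖ ≤ ‖x‖ := norm_le_norm_of_abs_le_abs (abs_le_abs_of_mem_fragments hy)
    have hd : dist (s • (x - y) + t • y) (s • x) < δ := by
      have : s • (x - y) + t • y - s • x = (t - s) • y := by module
      rw [dist_eq_norm, this, norm_smul, Real.norm_eq_abs]
      exact (mul_le_mul_of_nonneg_left hy' (abs_nonneg _)).trans_lt ht
    have h := hTδ _ hd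
    have hsx : T (s • x) = T (s • (x - y)) + T (s • y) := by
      rw [← hsplit y hy, ← smul_add, sub_add_cancel]
    rw [hsplit y hy, hsx, dist_add_left, dist_eq_norm] at h
    exact h.le
  have hiff : ∀ s : ℝ, ∀ᶠ t in nhds s, (t ∈ G ↔ s ∈ G) := by
    intro s
    filter_upwards [hnear s] with t ht
    refine ⟨fun ⟨C, hC⟩ => ⟨C + 1, fun y hy => ?_⟩, fun ⟨C, hC⟩ => ⟨C + 1, fun y hy => ?_⟩⟩
    · have h₁ := norm_sub_norm_le (T (s • y)) (T (t • y))
      rw [norm_sub_rev] at h₁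
      linarith [ht y hy, hC y hy]
    · have h₁ := norm_sub_norm_le (T (t • y)) (T (s • y))
      linarith [ht y hy, hC y hy]
  have hclopen : IsClopen G := by
    refine ⟨⟨?_⟩, ?_⟩
    · exact isOpen_iff_mem_nhds.2 fun s hs => (hiff s).mono fun t ht h => hs (ht.1 h)
    · exact isOpen_iff_mem_nhds.2 fun s hs => (hiff s).mono fun t ht => ht.2 hs
  have hmem : (1 : ℝ) ∈ G := by
    rw [hclopen.eq_univ ⟨0, 0, fun y _ => by simp [hT.map_zero]⟩]
    trivial
  obtain ⟨C, hC⟩ := hmem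
  refine isBounded_iff_forall_norm_le.2 ⟨C, ?_⟩
  rintro _ ⟨y, hy, rfl⟩
  simpa using hC y hy

lemma isBounded_iUnion_signedFragmentValues {X : Set E}
    (h : Bornology.IsBounded (T '' ⋃ x ∈ X, fragments x)) :
    Bornology.IsBounded (⋃ x ∈ X, signedFragmentValues T x) := by
  obtain ⟨C, hC⟩ := isBounded_iff_forall_norm_le.1 h
  refine isBounded_iff_forall_norm_le.2 ⟨C + C, fun z hz => ?_⟩
  obtain ⟨x, hx, y, hy, rfl⟩ := Set.mem_iUnion₂.1 hz
  exact (norm_sub_le _ _).trans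
    (add_le_add (hC _ ⟨y, Set.mem_biUnion hx hy, rfl⟩)
      (hC _ ⟨x - y, Set.mem_biUnion hx (sub_mem_fragments hy), rfl⟩))

end BoundedOnFragments

theorem theorem3p14
    {E : Type*} [NormedAddCommGroup E] [NormedSpace ℝ E] [Lattice E] [IsOrderedAddMonoid E]
    [IsOrderedModule ℝ E] [HasSolidNorm E] [CompleteSpace E]
    {F : Type*} [NormedAddCommGroup F] [NormedSpace ℝ F] [Lattice F] [IsOrderedAddMonoid F]
    [IsOrderedModule ℝ F] [HasSolidNorm F] [CompleteSpace F]
    (T : E → F) (hT : IsOrthogonallyAdditive T) (hfin : HasFiniteRank T)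
    (hreg : Continuous T ∨ IsLaterallyToOrderBounded T)
    (hbdd : Bornology.IsBounded (T '' Metric.closedBall (0 : E) 1)) :
    ∃ R : E → F, IsModulus T R ∧ IsCompactOrthogonallyAdditive R := by
  have : FiniteDimensional ℝ (Submodule.span ℝ (Set.range T)) := hfin
  obtain ⟨u, hu, hW⟩ := (Submodule.span ℝ (Set.range T)).exists_orderUnitTotallyBounded
  have hfrag : ∀ x, Bornology.IsBounded (T '' fragments x) := fun x =>
    hreg.elim (fun hc => hT.isBounded_image_fragments hc x) fun hl => hl.isBounded_image_fragments x
  have hex : ∀ x, ∃ s, IsLUB (signedFragmentValues T x) s := by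
    intro x
    have hb : Bornology.IsBounded (signedFragmentValues T x) := by
      simpa using isBounded_iUnion_signedFragmentValues (T := T) (X := {x}) (by simpa using hfrag x)
    exact (hW _ (signedFragmentValues_subset_span T x) hb).exists_isLUB hu
      (signedFragmentValues_nonempty T x)
  choose R hR using hex
  have hmod := isModulus_of_isLUB hT hR
  refine ⟨R, hmod, hmod.1.1, ?_⟩
  have hb : Bornology.IsBounded
      (⋃ x ∈ Metric.closedBall (0 : E) 1, signedFragmentValues T x) := by
    refine isBounded_iUnion_signedFragmentValues (hbdd.subset (Set.image_mono ?_))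
    refine Set.iUnion₂_subset fun x hx y hy => ?_
    rw [mem_closedBall_zero_iff] at hx ⊢
    exact (norm_le_norm_of_abs_le_abs (abs_le_abs_of_mem_fragments hy)).trans hx
  have htb := (hW _ (Set.iUnion₂_subset fun x _ => signedFragmentValues_subset_span T x)
    hb).totallyBounded_isLUB hu
  refine (TotallyBounded.closure (htb.subset ?_)).isCompact_of_isClosed isClosed_closure
  rintro _ ⟨x, hx, rfl⟩
  exact ⟨_, Set.subset_biUnion_of_mem (u := signedFragmentValues T) hx,
    signedFragmentValues_nonempty T x, hR x⟩
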